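/- Let $r, n, k, \lambda$ be non-negative integers with $r\le n\le k$, and let $\rho=(\rho_1,\dots,\rho_k)$ be a $k$-tuple of integers with $1\le\rho_\ell\le\lambda n$ for all $\ell\in[k]:=\{1,\dots,k\}$ and $\sum_{\ell=1}^k\rho_\ell=\lambda n^2$. An $r\times s$ $\lambda$-matrix on $[k]$ is an $r\times s$ array each of whose cells contains a multiset of exactly $\lambda$ elements (symbols) of $[k]$. For such an array $M$, let $|M_\ell|$ be the number of occurrences (with multiplicity) of the symbol $\ell$ in $M$, and for $K\subseteq[k]$ let $|{}^jM_K|$ be the number of occurrences of symbols of $K$ in column $j$ of $M$. An $r\times s$ $(\rho,\lambda)$-Latin rectangle is an $r\times s$ $\lambda$-matrix $M$ on $[k]$ in which every symbol $\ell$ occurs at most $\lambda$ times in each row, at most $\lambda$ times in each column, and at most $\rho_\ell$ times in total. An $n\times n$ $(\rho,\lambda)$-Latin square is an $n\times n$ $\lambda$-matrix on $[k]$ in which every symbol $\ell$ occurs at most $\lambda$ times in each row, at most $\lambda$ times in each column, and exactly $\rho_\ell$ times in total. Write $x \mathbin{\dot-} y:=\max\{0,x-y\}$. Let $M$ be an $r\times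 n$ $(\rho,\lambda)$-Latin rectangle. Then there is an $n\times n$ $(\rho,\lambda)$-Latin square whose first $r$ rows form $M$ if and only if both of the following conditions hold: (1) $\rho_\ell-|M_\ell|\le\lambda(n-r)$ for all $\ell\in[k]$; (2) $\displaystyle\sum_{j=1}^n\Big(\big(\lambda n-\lambda r+|{}^jM_K|\big)\mathbin{\dot-}\lambda|K|\Big)\le\sum_{\ell\in[k]\setminus K}\big(\rho_\ell-|M_\ell|\big)$ for all $K\subseteq[k]$. -/

import Mathlib

open scoped BigOperators

/-- An `r × s` `lam`-matrix on the symbols `Fin k`: each cell holds a multiset of exactly `lam`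
symbols. -/
abbrev LamMatrix (r s k lam : ℕ) : Type := Fin r → Fin s → Sym (Fin k) lam

namespace LamMatrix

variable {r s k lam : ℕ}

/-- The number of occurrences of the symbol `l` in the cell `(i, j)`. -/
def cellCount (M : LamMatrix r s k lam) (i : Fin r) (j : Fin s) (l : Fin k) : ℕ :=
  Multiset.count l (M i j : Multiset (Fin k))

/-- `|M_l|`, the number of occurrences of the symbol `l` in `M`. -/
def count (M : LamMatrix r s k lam) (l : Fin k) : ℕ :=
  ∑ i : Fin r, ∑ j : Fin s, M.cellCount i j l

/-- The number of occurrences of the symbol `l` in row `i` of `M`. -/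
def rowCount (M : LamMatrix r s k lam) (i : Fin r) (l : Fin k) : ℕ :=
  ∑ j : Fin s, M.cellCount i j l

/-- The number of occurrences of the symbol `l` in column `j` of `M`. -/
def colCount (M : LamMatrix r s k lam) (j : Fin s) (l : Fin k) : ℕ :=
  ∑ i : Fin r, M.cellCount i j l

/-- The number of occurrences of symbols of `K` in column `j` of `M`. -/
def colCountSet (M : LamMatrix r s k lam) (j : Fin s) (K : Finset (Fin k)) : ℕ :=
  ∑ l ∈ K, M.colCount j l

/-- `M` is an `r × s` `(ρ, lam)`-Latin rectangle. -/
structure IsLatinRectangle (M : LamMatrix r s k lam) (ρ : Fin k → ℕ) : Prop where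
  count_le : ∀ l, M.count l ≤ ρ l
  rowCount_le : ∀ i l, M.rowCount i l ≤ lam
  colCount_le : ∀ j l, M.colCount j l ≤ lam

/-- `N` is an `n × n` `(ρ, lam)`-Latin square. -/
structure IsLatinSquare {n : ℕ} (N : LamMatrix n n k lam) (ρ : Fin k → ℕ) : Prop where
  count_eq : ∀ l, N.count l = ρ l
  rowCount_le : ∀ i l, N.rowCount i l ≤ lam
  colCount_le : ∀ j l, N.colCount j l ≤ lam

/-- `N` extends `M`: the top left `r × s` block of `N` is `M`. -/
def Extends {r' s' : ℕ} (N : LamMatrix r' s' k lam) (M : LamMatrix r s k lam)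
    (hr : r ≤ r') (hs : s ≤ s') : Prop :=
  ∀ i j, N (Fin.castLE hr i) (Fin.castLE hs j) = M i j

end LamMatrix

/-- Truncated subtraction `max {0, x - y}`. -/
def truncSub (x y : ℤ) : ℤ := max 0 (x - y)

/-! The missing `m = n - r` rows are built in two stages. First choose the number `x j l` of copies
of symbol `l` placed below `M` in column `j`: column `j` takes `lam * m` symbols, symbol `l` is used
`ρ l - M.count l` times, and `x j l` is at most `lam - M.colCount j l`. This is a balanced
transportation problem, solved by `exists_transport_eq` (Hall's theorem); its cut conditions, at the
worst set of columns for each `K`, are condition (2). Then distribute `x` over the new rows: by (1)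
every symbol total is at most `lam * m`, so `exists_decomposition` splits `x` into `m` layers, one
per row, much as a bipartite multigraph splits into factors. Conversely, (1) and (2) follow by
counting in the added rows. -/

section Transport

variable {ι κ : Type*} [Fintype ι] [Fintype κ] [DecidableEq ι] [DecidableEq κ]

/-- A capacitated transportation problem satisfying all cut conditions has an integral solution
that meets every supply and exceeds no demand. -/
theorem exists_transport_le (a : ι → ℕ) (b : κ → ℕ) (u : ι → κ → ℕ)
    (h : ∀ (J : Finset ι) (K : Finset κ),
      ∑ j ∈ J, a j ≤ ∑ j ∈ J, ∑ l ∈ K, u j l + ∑ l ∈ Kᶜ, b l) :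
    ∃ x : ι → κ → ℕ, (∀ j l, x j l ≤ u j l) ∧ (∀ j, a j ≤ ∑ l, x j l) ∧
      ∀ l, ∑ j, x j l ≤ b l := by
  classical
  have ha : ∀ j, a j ≤ ∑ l, u j l := fun j => by simpa using h {j} Finset.univ
  -- Hall's theorem on units of capacity: a unit at `(j, l)` is matched to a demand slot of `l`
  -- (used) or to one of the `∑ l, u j l - a j` waste slots of `j` (unused). The waste slots bound
  -- the unused units, so at least `a j` are used.
  let nb : (Σ p : ι × κ, Fin (u p.1 p.2)) →
      Finset ((Σ l : κ, Fin (b l)) ⊕ (Σ j : ι, Fin (∑ l, u j l - a j))) := fun z =>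
    (({z.1.2} : Finset κ).sigma fun _ => Finset.univ).disjSum
      (({z.1.1} : Finset ι).sigma fun _ => Finset.univ)
  have hall : ∀ A : Finset (Σ p : ι × κ, Fin (u p.1 p.2)), A.card ≤ (A.biUnion nb).card := by
    intro A
    let J := A.image fun z => z.1.1
    let L := A.image fun z => z.1.2
    have h1 : A.card ≤ ∑ j ∈ J, ∑ l ∈ L, u j l := by
      have : A ⊆ (J ×ˢ L).sigma fun _ => Finset.univ := by
        intro z hz
        simp only [Finset.mem_sigma, Finset.mem_product, Finset.mem_univ, and_true]
        exact ⟨Finset.mem_image_of_mem _ hz, Finset.mem_image_of_mem _ hz⟩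
      refine (Finset.card_le_card this).trans_eq ?_
      rw [Finset.card_sigma, Finset.sum_product]
      simp
    have h2 : ∑ l ∈ L, b l + ∑ j ∈ J, (∑ l, u j l - a j) ≤ (A.biUnion nb).card := by
      have : (L.sigma fun l => (Finset.univ : Finset (Fin (b l)))).disjSum
          (J.sigma fun j => (Finset.univ : Finset (Fin (∑ l, u j l - a j)))) ⊆ A.biUnion nb := by
        rintro (⟨l, i⟩ | ⟨j, i⟩) hs
        · simp only [Finset.inl_mem_disjSum, Finset.mem_sigma, Finset.mem_univ, and_true, L,
            Finset.mem_image] at hs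
          obtain ⟨z, hz, rfl⟩ := hs
          exact Finset.mem_biUnion.2 ⟨z, hz, by simp [nb]⟩
        · simp only [Finset.inr_mem_disjSum, Finset.mem_sigma, Finset.mem_univ, and_true, J,
            Finset.mem_image] at hs
          obtain ⟨z, hz, rfl⟩ := hs
          exact Finset.mem_biUnion.2 ⟨z, hz, by simp [nb]⟩
      refine le_trans (le_of_eq ?_) (Finset.card_le_card this)
      simp [Finset.card_disjSum, Finset.card_sigma]
    have h3 := h J Lᶜ
    rw [compl_compl] at h3
    have h4 : ∑ j ∈ J, (∑ l, u j l - a j) + ∑ j ∈ J, a j = ∑ j ∈ J, ∑ l, u j l := by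
      rw [← Finset.sum_add_distrib]
      exact Finset.sum_congr rfl fun j _ => Nat.sub_add_cancel (ha j)
    have h5 : ∑ j ∈ J, ∑ l, u j l = ∑ j ∈ J, ∑ l ∈ L, u j l + ∑ j ∈ J, ∑ l ∈ Lᶜ, u j l := by
      rw [← Finset.sum_add_distrib]
      exact Finset.sum_congr rfl fun j _ => (Finset.sum_add_sum_compl L _).symm
    omega
  obtain ⟨f, hf, hfm⟩ := (Finset.all_card_le_biUnion_card_iff_exists_injective nb).1 hall
  have hleft : ∀ z q, f z = Sum.inl q → q.1 = z.1.2 := by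
    intro z q hq
    have := hfm z
    rw [hq] at this
    simpa [nb] using this
  have hright : ∀ z q, f z = Sum.inr q → q.1 = z.1.1 := by
    intro z q hq
    have := hfm z
    rw [hq] at this
    simpa [nb] using this
  let X : ι → κ →
      Finset (Σ p : ι × κ, Fin (u p.1 p.2)) := fun j l =>
    {z ∈ ({(j, l)} : Finset (ι × κ)).sigma fun p => (Finset.univ : Finset (Fin (u p.1 p.2))) |
      (f z).isLeft}
  let Y : ι → κ →
      Finset (Σ p : ι × κ, Fin (u p.1 p.2)) := fun j l =>
    {z ∈ ({(j, l)} : Finset (ι × κ)).sigma fun p => (Finset.univ : Finset (Fin (u p.1 p.2))) |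
      ¬ (f z).isLeft}
  have hX : ∀ j l z, z ∈ X j l ↔ z.1 = (j, l) ∧ (f z).isLeft := by simp [X]
  have hY : ∀ j l z, z ∈ Y j l ↔ z.1 = (j, l) ∧ ¬ (f z).isLeft := by simp [Y]
  have hXY : ∀ j l, (X j l).card + (Y j l).card = u j l := by
    intro j l
    simp only [X, Y]
    rw [Finset.card_filter_add_card_filter_not, Finset.card_sigma]
    simp
  refine ⟨fun j l => (X j l).card, fun j l => (hXY j l) ▸ Nat.le_add_right _ _, fun j => ?_,
    fun l => ?_⟩
  · have h1 : ∑ l, (Y j l).card ≤ ∑ l, u j l - a j := by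
      rw [← Finset.card_biUnion]
      · have : (Finset.univ.biUnion fun l => Y j l).image f ⊆
            (({j} : Finset ι).sigma fun j =>
              (Finset.univ : Finset (Fin (∑ l, u j l - a j)))).map ⟨Sum.inr, Sum.inr_injective⟩ := by
          intro s hs
          simp only [Finset.mem_image, Finset.mem_biUnion, Finset.mem_univ, true_and, hY] at hs
          obtain ⟨z, ⟨l, hz, hs⟩, rfl⟩ := hs
          rcases hq : f z with q | q
          · simp [hq] at hs
          · have := hright z q hq
            simp [this, hz]
        have := Finset.card_le_card this
        rw [Finset.card_image_of_injective _ hf] at this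
        simpa [Finset.card_sigma] using this
      · intro l _ l' _ hne
        refine Finset.disjoint_left.2 fun z hz hz' => hne ?_
        rw [hY] at hz hz'
        exact (Prod.ext_iff.1 (hz.1.symm.trans hz'.1)).2
    have h2 : ∑ l, (X j l).card + ∑ l, (Y j l).card = ∑ l, u j l := by
      rw [← Finset.sum_add_distrib]
      exact Finset.sum_congr rfl fun l _ => hXY j l
    have := ha j
    simp only
    omega
  · rw [← Finset.card_biUnion]
    · have : (Finset.univ.biUnion fun j => X j l).image f ⊆
          (({l} : Finset κ).sigma fun l =>
            (Finset.univ : Finset (Fin (b l)))).map ⟨Sum.inl, Sum.inl_injective⟩ := by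
        intro s hs
        simp only [Finset.mem_image, Finset.mem_biUnion, Finset.mem_univ, true_and, hX] at hs
        obtain ⟨z, ⟨j, hz, hs⟩, rfl⟩ := hs
        rcases hq : f z with q | q
        · have := hleft z q hq
          simp [this, hz]
        · simp [hq] at hs
      have := Finset.card_le_card this
      rw [Finset.card_image_of_injective _ hf] at this
      simpa [Finset.card_sigma] using this
    · intro j _ j' _ hne
      refine Finset.disjoint_left.2 fun z hz hz' => hne ?_
      rw [hX] at hz hz'
      exact (Prod.ext_iff.1 (hz.1.symm.trans hz'.1)).1

/-- A balanced capacitated transportation problem satisfying all cut conditions has an integral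
solution. -/
theorem exists_transport_eq (a : ι → ℕ) (b : κ → ℕ) (u : ι → κ → ℕ)
    (hab : ∑ j, a j = ∑ l, b l)
    (h : ∀ (J : Finset ι) (K : Finset κ),
      ∑ j ∈ J, a j ≤ ∑ j ∈ J, ∑ l ∈ K, u j l + ∑ l ∈ Kᶜ, b l) :
    ∃ x : ι → κ → ℕ, (∀ j l, x j l ≤ u j l) ∧ (∀ j, ∑ l, x j l = a j) ∧
      ∀ l, ∑ j, x j l = b l := by
  obtain ⟨x, hxu, hxa, hxb⟩ := exists_transport_le a b u h
  have h1 : ∑ j, a j ≤ ∑ j, ∑ l, x j l := Finset.sum_le_sum fun j _ => hxa j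
  have h2 : ∑ l, ∑ j, x j l ≤ ∑ l, b l := Finset.sum_le_sum fun l _ => hxb l
  have h3 : ∑ j, ∑ l, x j l = ∑ l, ∑ j, x j l := Finset.sum_comm
  refine ⟨x, hxu, fun j => ?_, fun l => ?_⟩
  · exact ((Finset.sum_eq_sum_iff_of_le fun j _ => hxa j).1 (by omega) j
      (Finset.mem_univ j)).symm
  · exact (Finset.sum_eq_sum_iff_of_le fun l _ => hxb l).1 (by omega) l (Finset.mem_univ l)

/-! ### Splitting a matrix into layers -/

/-- A nonnegative integer matrix all of whose line sums are `d * m` is a sum of `m` nonnegative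
integer matrices all of whose line sums are `d`. -/
theorem exists_decomposition_of_regular (d m : ℕ) (x : ι → κ → ℕ)
    (hrow : ∀ j, ∑ l, x j l = d * m) (hcol : ∀ l, ∑ j, x j l = d * m) :
    ∃ y : Fin m → ι → κ → ℕ, (∀ j l, ∑ t, y t j l = x j l) ∧
      (∀ t j, ∑ l, y t j l = d) ∧ ∀ t l, ∑ j, y t j l = d := by
  induction m generalizing x with
  | zero =>
    refine ⟨fun t => t.elim0, fun j l => ?_, fun t => t.elim0, fun t => t.elim0⟩
    have := hrow j
    rw [Nat.mul_zero, Finset.sum_eq_zero_iff] at this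
    simp [this l (Finset.mem_univ l)]
  | succ m ih =>
    have hsum : ∑ _j : ι, d = ∑ _l : κ, d := by
      have : ∑ j, ∑ l, x j l = ∑ l, ∑ j, x j l := Finset.sum_comm
      simp only [hrow, hcol, Finset.sum_const, smul_eq_mul] at this ⊢
      rw [← mul_assoc, ← mul_assoc] at this
      exact Nat.eq_of_mul_eq_mul_right m.succ_pos this
    -- The matrix `x / (m + 1)` is a fractional solution, so the cut conditions hold; they are
    -- checked after multiplying by `m + 1`.
    obtain ⟨y, hyx, hya, hyb⟩ := exists_transport_eq (fun _ => d) (fun _ => d) x hsum (by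
      intro J K
      have h1 : ∑ j ∈ J, ∑ l, x j l = J.card * d * (m + 1) := by
        simp [hrow, mul_assoc]
      have h2 : ∑ j ∈ J, ∑ l, x j l = ∑ j ∈ J, ∑ l ∈ K, x j l + ∑ j ∈ J, ∑ l ∈ Kᶜ, x j l := by
        rw [← Finset.sum_add_distrib]
        exact Finset.sum_congr rfl fun j _ => (Finset.sum_add_sum_compl K _).symm
      have h3 : ∑ j ∈ J, ∑ l ∈ Kᶜ, x j l ≤ Kᶜ.card * d * (m + 1) := by
        rw [Finset.sum_comm]
        calc ∑ l ∈ Kᶜ, ∑ j ∈ J, x j l ≤ ∑ l ∈ Kᶜ, d * (m + 1) :=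
              Finset.sum_le_sum fun l _ => (hcol l) ▸
                Finset.sum_le_sum_of_subset (Finset.subset_univ J)
          _ = _ := by simp [mul_assoc]
      simp only [Finset.sum_const, smul_eq_mul]
      refine Nat.le_of_mul_le_mul_right (c := m + 1) ?_ m.succ_pos
      rw [add_mul]
      have h4 := Nat.le_mul_of_pos_right (∑ j ∈ J, ∑ l ∈ K, x j l) m.succ_pos
      simp only [Nat.succ_eq_add_one] at h4
      omega)
    obtain ⟨z, hz, hza, hzb⟩ := ih (fun j l => x j l - y j l)
      (fun j => by
        have := Finset.sum_tsub_distrib (s := Finset.univ) (f := x j) (g := y j) fun l _ => hyx j l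
        rw [this, hrow, hya, Nat.mul_succ, Nat.add_sub_cancel])
      (fun l => by
        have := Finset.sum_tsub_distrib (s := Finset.univ) (f := fun j => x j l)
          (g := fun j => y j l) fun j _ => hyx j l
        rw [this, hcol, hyb, Nat.mul_succ, Nat.add_sub_cancel])
    refine ⟨Fin.cons y z, fun j l => ?_, fun t => ?_, fun t => ?_⟩
    · rw [Fin.sum_univ_succ]
      simp only [Fin.cons_zero, Fin.cons_succ, hz]
      exact Nat.add_sub_cancel' (hyx j l)
    · refine Fin.cases ?_ (fun t => ?_) t
      · simpa using hya
      · simpa using hza t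
    · refine Fin.cases ?_ (fun t => ?_) t
      · simpa using hyb
      · simpa using hzb t

/-- A nonnegative integer matrix with all row sums equal to `d * m` and all column sums at
most `d * m` is a sum of `m` nonnegative integer matrices with all row sums equal to `d` and all column sums at most `d`. -/
theorem exists_decomposition (d m : ℕ) (x : ι → κ → ℕ)
    (hrow : ∀ j, ∑ l, x j l = d * m) (hcol : ∀ l, ∑ j, x j l ≤ d * m) :
    ∃ y : Fin m → ι → κ → ℕ, (∀ j l, ∑ t, y t j l = x j l) ∧
      (∀ t j, ∑ l, y t j l = d) ∧ ∀ t l, ∑ j, y t j l ≤ d := by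
  -- Pad with extra rows `w` to reach the regular case. If there are fewer columns than rows, then
  -- `d * m = 0` and the truncated difference is harmless.
  have hsum : ∑ l, (d * m - ∑ j, x j l) = (Fintype.card κ - Fintype.card ι) * (d * m) := by
    rw [Finset.sum_tsub_distrib _ fun l _ => hcol l, Finset.sum_comm]
    simp [hrow, Nat.sub_mul]
  obtain ⟨w, -, hwa, hwb⟩ := exists_transport_eq (ι := Fin (Fintype.card κ - Fintype.card ι))
    (fun _ => d * m) (fun l => d * m - ∑ j, x j l) (fun _ _ => d * m) (by simp [hsum]) (by
      intro J K
      rcases K.eq_empty_or_nonempty with rfl | hK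
      · simp only [Finset.sum_const, smul_eq_mul, Finset.compl_empty, hsum]
        have := Nat.mul_le_mul_right (d * m) (J.card_le_univ)
        simpa using this
      · refine le_add_right (Finset.sum_le_sum fun j _ => ?_)
        rw [Finset.sum_const, smul_eq_mul]
        exact Nat.le_mul_of_pos_left _ hK.card_pos)
  obtain ⟨y, hy, hya, hyb⟩ := exists_decomposition_of_regular d m
    (Sum.elim x w) (by rintro (j | j) <;> simp [hrow, hwa]) (by
      intro l
      rw [Fintype.sum_sum_type]
      simpa [hwb] using Nat.add_sub_cancel' (hcol l))
  refine ⟨fun t j => y t (Sum.inl j), fun j l => hy (Sum.inl j) l, fun t j => hya t _,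
    fun t l => ?_⟩
  have := hyb t l
  rw [Fintype.sum_sum_type] at this
  exact this ▸ Nat.le_add_right _ _

end Transport

/-! ### Symbol counts and stacking -/

namespace LamMatrix

variable {r m s k lam : ℕ}

/-- The sum of all symbol counts in a cell is `lam`. -/
theorem sum_cellCount (M : LamMatrix r s k lam) (i : Fin r) (j : Fin s) :
    ∑ l, M.cellCount i j l = lam := by
  unfold cellCount
  rw [Multiset.sum_count_eq_card (fun a _ => Finset.mem_univ a)]
  exact (M i j).2

theorem sum_colCount (M : LamMatrix r s k lam) (j : Fin s) :
    ∑ l, M.colCount j l = lam * r := by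
  unfold colCount
  rw [Finset.sum_comm]
  simp [sum_cellCount, mul_comm]

theorem count_eq_sum_colCount (M : LamMatrix r s k lam) (l : Fin k) :
    M.count l = ∑ j, M.colCount j l := by
  unfold count colCount
  exact Finset.sum_comm

/-- A nonnegative integer array with cell sums `lam` is the array of symbol counts of a
`lam`-matrix. -/
theorem exists_cellCount_eq (y : Fin r → Fin s → Fin k → ℕ) (hy : ∀ i j, ∑ l, y i j l = lam) :
    ∃ N : LamMatrix r s k lam, ∀ i j l, N.cellCount i j l = y i j l := by
  refine ⟨fun i j => ⟨∑ l, y i j l • ({l} : Multiset (Fin k)), by simp [hy]⟩, fun i j l => ?_⟩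
  simp [cellCount, Multiset.count_sum', Multiset.count_singleton]

/-- The matrix with `M` on top of `P`. -/
def stack (M : LamMatrix r s k lam) (P : LamMatrix m s k lam) : LamMatrix (r + m) s k lam :=
  Fin.addCases M P

theorem extends_iff_exists_stack (M : LamMatrix r s k lam) (N : LamMatrix (r + m) s k lam) :
    N.Extends M (Nat.le_add_right r m) le_rfl ↔ ∃ P : LamMatrix m s k lam, N = M.stack P := by
  constructor
  · intro h
    refine ⟨fun i => N (Fin.natAdd r i), funext fun i => ?_⟩
    refine Fin.addCases (fun i => ?_) (fun i => ?_) i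
    · exact (funext (h i)).trans (by simp [stack])
    · simp [stack]
  · rintro ⟨P, rfl⟩ i j
    change (Fin.addCases M P (Fin.castAdd m i) : Fin s → Sym (Fin k) lam) j = M i j
    rw [Fin.addCases_left]

theorem rowCount_stack_castAdd (M : LamMatrix r s k lam) (P : LamMatrix m s k lam) (i : Fin r)
    (l : Fin k) : (M.stack P).rowCount (Fin.castAdd m i) l = M.rowCount i l := by
  simp [rowCount, cellCount, stack]

theorem rowCount_stack_natAdd (M : LamMatrix r s k lam) (P : LamMatrix m s k lam) (i : Fin m)
    (l : Fin k) : (M.stack P).rowCount (Fin.natAdd r i) l = P.rowCount i l := by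
  simp [rowCount, cellCount, stack]

theorem colCount_stack (M : LamMatrix r s k lam) (P : LamMatrix m s k lam) (j : Fin s)
    (l : Fin k) : (M.stack P).colCount j l = M.colCount j l + P.colCount j l := by
  simp [colCount, cellCount, stack, Fin.sum_univ_add]

theorem count_stack (M : LamMatrix r s k lam) (P : LamMatrix m s k lam) (l : Fin k) :
    (M.stack P).count l = M.count l + P.count l := by
  simp [count_eq_sum_colCount, colCount_stack, Finset.sum_add_distrib]

/-- Placing `P` below a Latin rectangle `M` gives a Latin square exactly when `P` supplies the
missing symbols and respects the row and column bounds. -/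
theorem isLatinSquare_stack_iff {M : LamMatrix r (r + m) k lam} {ρ : Fin k → ℕ}
    (hM : M.IsLatinRectangle ρ) (P : LamMatrix m (r + m) k lam) :
    (M.stack P).IsLatinSquare ρ ↔ (∀ l, M.count l + P.count l = ρ l) ∧
      (∀ i l, P.rowCount i l ≤ lam) ∧ ∀ j l, M.colCount j l + P.colCount j l ≤ lam := by
  constructor
  · intro h
    refine ⟨fun l => ?_, fun i l => ?_, fun j l => ?_⟩
    · rw [← count_stack]; exact h.count_eq l
    · rw [← rowCount_stack_natAdd M]; exact h.rowCount_le _ l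
    · rw [← colCount_stack]; exact h.colCount_le j l
  · rintro ⟨h1, h2, h3⟩
    refine ⟨fun l => (count_stack M P l).trans (h1 l), fun i l => ?_, fun j l =>
      (colCount_stack M P j l).trans_le (h3 j l)⟩
    refine Fin.addCases (fun i => ?_) (fun i => ?_) i
    · rw [rowCount_stack_castAdd]; exact hM.rowCount_le i l
    · rw [rowCount_stack_natAdd]; exact h2 i l

end LamMatrix

/-! ### The extension criterion -/

theorem mainTheorem6 (r n k lam : ℕ) (hrn : r ≤ n) (hnk : n ≤ k) (ρ : Fin k → ℕ)
    (hρ_pos : ∀ l, 1 ≤ ρ l) (hρ_le : ∀ l, ρ l ≤ lam * n) (hρ_sum : ∑ l, ρ l = lam * n ^ 2)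
    (M : LamMatrix r n k lam) (hM : M.IsLatinRectangle ρ) :
    (∃ N : LamMatrix n n k lam, N.IsLatinSquare ρ ∧ N.Extends M hrn le_rfl) ↔
      ((∀ l : Fin k, (ρ l : ℤ) - (M.count l : ℤ) ≤ (lam : ℤ) * ((n : ℤ) - (r : ℤ))) ∧
        ∀ K : Finset (Fin k),
          ∑ j : Fin n, truncSub
              ((lam : ℤ) * (n : ℤ) - (lam : ℤ) * (r : ℤ) + (M.colCountSet j K : ℤ))
              ((lam : ℤ) * (K.card : ℤ)) ≤
            ∑ l ∈ Kᶜ, ((ρ l : ℤ) - (M.count l : ℤ))) := by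
  obtain ⟨m, rfl⟩ := Nat.exists_eq_add_of_le hrn
  constructor
  · rintro ⟨N, hN, hNM⟩
    obtain ⟨P, rfl⟩ := (LamMatrix.extends_iff_exists_stack M N).1 hNM
    obtain ⟨h1, h2, h3⟩ := (LamMatrix.isLatinSquare_stack_iff hM P).1 hN
    have hd : ∀ l, (ρ l : ℤ) - (M.count l : ℤ) = P.count l := fun l => by
      rw [← h1 l]; push_cast; ring
    simp only [hd]
    refine ⟨fun l => ?_, fun K => ?_⟩
    · have : P.count l ≤ ∑ _i : Fin m, lam := Finset.sum_le_sum fun i _ => h2 i l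
      have : (P.count l : ℤ) ≤ ((m * lam : ℕ) : ℤ) := by exact_mod_cast (by simpa using this)
      push_cast at this ⊢
      linarith
    · have hP : ∑ l ∈ Kᶜ, (P.count l : ℤ) = ∑ j, ((∑ l ∈ Kᶜ, P.colCount j l : ℕ) : ℤ) := by
        simp only [LamMatrix.count_eq_sum_colCount]
        push_cast
        exact Finset.sum_comm
      rw [hP]
      -- Column by column: of the `lam * m` new symbols in column `j`, at most `lam * K.card -
      -- M.colCountSet j K` lie in `K`, and the rest lie in `Kᶜ`.
      refine Finset.sum_le_sum fun j _ => max_le (by positivity) ?_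
      have e1 : ∑ l ∈ K, P.colCount j l + ∑ l ∈ Kᶜ, P.colCount j l = lam * m := by
        rw [Finset.sum_add_sum_compl, LamMatrix.sum_colCount]
      have e2 : M.colCountSet j K + ∑ l ∈ K, P.colCount j l ≤ K.card * lam := by
        unfold LamMatrix.colCountSet
        rw [← Finset.sum_add_distrib]
        simpa using Finset.sum_le_sum fun l (_ : l ∈ K) => h3 j l
      zify at e1 e2
      push_cast
      linarith
  · rintro ⟨h1, h2⟩
    have hbal : ∑ _j : Fin (r + m), lam * m = ∑ l, (ρ l - M.count l) := by
      rw [Finset.sum_tsub_distrib _ fun l _ => hM.count_le l, hρ_sum]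
      simp only [LamMatrix.count_eq_sum_colCount]
      rw [Finset.sum_comm]
      simp only [LamMatrix.sum_colCount, Finset.sum_const, Finset.card_univ, Fintype.card_fin,
        smul_eq_mul]
      refine (Nat.sub_eq_of_eq_add ?_).symm
      ring
    obtain ⟨x, hxu, hxa, hxb⟩ := exists_transport_eq (fun _ : Fin (r + m) => lam * m)
      (fun l => ρ l - M.count l) (fun j l => lam - M.colCount j l) hbal (by
        intro J K
        have hb : ((∑ l ∈ Kᶜ, (ρ l - M.count l) : ℕ) : ℤ) =
            ∑ l ∈ Kᶜ, ((ρ l : ℤ) - (M.count l : ℤ)) := by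
          push_cast
          exact Finset.sum_congr rfl fun l _ => Nat.cast_sub (hM.count_le l)
        have hu : ((∑ j ∈ J, ∑ l ∈ K, (lam - M.colCount j l) : ℕ) : ℤ) =
            ∑ j ∈ J, ((lam : ℤ) * K.card - M.colCountSet j K) := by
          push_cast
          refine Finset.sum_congr rfl fun j _ => ?_
          simp only [Nat.cast_sub (hM.colCount_le j _), LamMatrix.colCountSet]
          simp [mul_comm]
        zify
        push_cast at hb hu
        rw [hb, hu, ← sub_le_iff_le_add', ← Finset.sum_sub_distrib]
        -- Any sum over `J` is at most the sum of positive parts over all columns, so (2) covers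
        -- every `J` at once.
        refine le_trans ?_ (h2 K)
        refine le_trans (Finset.sum_le_sum fun j _ => ?_)
          (Finset.sum_le_sum_of_subset_of_nonneg (Finset.subset_univ J) fun j _ _ =>
            le_max_left _ _)
        refine le_trans (le_of_eq ?_) (le_max_right _ _)
        push_cast
        ring)
    -- Layer `t` becomes the `t`-th new row: its sums over symbols fill each cell with `lam`
    -- symbols, and its sums over columns give the row bound.
    obtain ⟨y, hyx, hya, hyb⟩ := exists_decomposition lam m x hxa (fun l => by
      rw [hxb]
      have := h1 l
      push_cast at this
      zify [hM.count_le l]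
      linarith)
    obtain ⟨P, hP⟩ := LamMatrix.exists_cellCount_eq y hya
    have hcol : ∀ j l, P.colCount j l = x j l := fun j l => by
      simp only [LamMatrix.colCount, hP, hyx]
    refine ⟨M.stack P, (LamMatrix.isLatinSquare_stack_iff hM P).2 ⟨fun l => ?_, fun i l => ?_,
      fun j l => ?_⟩, (LamMatrix.extends_iff_exists_stack M _).2 ⟨P, rfl⟩⟩
    · simp only [LamMatrix.count_eq_sum_colCount P, hcol, hxb]
      exact Nat.add_sub_cancel' (hM.count_le l)
    · simpa only [LamMatrix.rowCount, hP] using hyb i l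
    · rw [hcol]
      have := hxu j l
      have := hM.colCount_le j l
      omega
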